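/- **Setting.** $n$ arms arrive one after another in a stream; arm $i$ gives independent Bernoulli rewards with mean $\mu_i\in[0,1]$. In each of $T$ rounds the player may discard arms from memory and read further arms of the stream, and then pulls one arm $A_t$ that is in memory and observes its reward. At most $m$ arms may be in memory, and a discarded or skipped arm cannot be read again. Let $\mu_*=\max_i\mu_i$, $\Delta_i=\mu_*-\mu_i$, and $\mathbb E[R(T)]=\mathbb E\big[\sum_{t=1}^T(\mu_*-\mu_{A_t})\big]$. **Algorithm** (inputs $T$, $m$, $n$, $\alpha\ge1$). Let $L=\Big\lceil\big(\tfrac{2\alpha}{e}\big)^{\frac{\alpha}{\alpha+1}}\big(\tfrac Tm\big)^{\frac1{\alpha+1}}\Big\rceil$. Read the first $m-1$ arms into memory and pull each of them $L$ times, recording the empirical mean $\hat\mu_j$ of each. Whenever a further arm $i$ arrives, choose an arm $j$ uniformly at random among the $m-1$ arms in memory, read arm $i$ into memory, pull it $L$ times and compute its empirical mean $\hat\mu_i$; if $\hat\mu_i>\hat\mu_j$ discard arm $j$, otherwise discard arm $i$. When the stream has ended, run UCB($\delta$) afresh on the $m-1$ arms in memory until round $T$, with $\delta=T^{-\kappa}$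 for a fixed $\kappa\ge1$: in every round pull an arm with the largest index, where the index of an arm that UCB has not yet pulled is $\infty$ and that of an arm which it has pulled $N\ge1$ times with average reward $\bar\mu$ is $\bar\mu+\sqrt{2\log(1/\delta)/N}$; ties are broken by an arbitrary fixed rule depending on the round and the set of maximizers. **Theorem.** There is a universal constant $C>0$ such that for all $\alpha\ge1$, $\kappa\ge1$ and all integers $n,m$ with $2\le m<\frac23n$ there is a $T_0$, depending only on $\alpha,\kappa,n,m$, such that for every $T\ge T_0$ and every instance $(\mu_1,\dots,\mu_n)\in[0,1]^n$ (listed in the order of the stream) the algorithm reads the stream in a single pass, never has more than $m$ arms in memory, and satisfies $$\mathbb E[R(T)]\le C\,\Big(\frac{2\alpha}{e}\Big)^{\frac{\alpha}{\alpha+1}}\Big(\frac Tm\Big)^{\frac1{\alpha+1}}\sum_{i:\Delta_i>0}\Delta_i^{1-2\alpha}.$$ -/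

import Mathlib

namespace StreamingBandit

open MeasureTheory ProbabilityTheory

/-! ### Bandit instances

An instance with `n` Bernoulli arms is a vector `μ : Fin n → unitInterval` of reward means,
listed in the order in which the arms arrive in the stream. -/

/-- The largest reward mean. -/
noncomputable def bestMean {n : ℕ} (μ : Fin n → unitInterval) : ℝ :=
  ⨆ j, (μ j : ℝ)

/-- The gap of arm `i`: the largest reward mean minus the reward mean of arm `i`. -/
noncomputable def gap {n : ℕ} (μ : Fin n → unitInterval) (i : Fin n) : ℝ :=
  bestMean μ - μ i

/-- The regret over `T` rounds of a sequence of pulled arms (arm `A t` is pulled in round `t`). -/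
noncomputable def regret {n : ℕ} (μ : Fin n → unitInterval) (T : ℕ) (A : ℕ → Fin n) : ℝ :=
  ∑ t ∈ Finset.range T, (bestMean μ - μ (A t))

/-! ### The randomness of a game with `T` rounds

Arm `i` has a list of rewards, and its `s`-th pull (counted from `0`) returns the `s`-th entry of
this list. An arm is pulled at most `T` times, so `T` entries per arm are enough. The second
component holds, for each arm of the stream, the memory cell which the player draws when that arm
arrives; there are `k` cells. -/

/-- Reward lists of the `n` arms and the player's random choices of a cell. -/
abbrev Outcome (n k T : ℕ) : Type := (Fin n × Fin T → Bool) × (Fin n → Fin k)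

/-- All rewards and all choices are independent, the rewards of arm `i` are Bernoulli with
mean `μ i`, and the choices are uniform. -/
noncomputable def law {n : ℕ} (k T : ℕ) (μ : Fin n → unitInterval) : Measure (Outcome n k T) :=
  (Measure.pi fun p : Fin n × Fin T => bernoulliMeasure true false (μ p.1)).prod
    (Measure.pi fun _ : Fin n => uniformOn (Set.univ : Set (Fin k)))

/-- The reward of pull number `s` of arm `i`. (Pull numbers `s ≥ T` do not occur in `T` rounds.) -/
noncomputable def reward {n k T : ℕ} (ω : Outcome n k T) (i : Fin n) (s : ℕ) : ℝ :=
  if h : s < T then (if ω.1 (i, ⟨s, h⟩) then 1 else 0) else 0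

/-! ### The exploration phase

Each arm is pulled `L` times as soon as it is in memory. The memory has `k` cells for arms that are
retained, and one further place for the incoming arm. -/

/-- The empirical mean of arm `i` over its first `L` pulls. -/
noncomputable def exploreMean {n k T : ℕ} (L : ℕ) (ω : Outcome n k T) (i : Fin n) : ℝ :=
  (∑ s ∈ Finset.range L, reward ω i s) / L

open Classical in
/-- The arms in the cells after the first `k` arms have been stored and `a` further arms have
arrived. The incoming arm `i` is compared with the arm in a uniformly random cell; it takes over the
cell if its empirical mean is larger, and otherwise it is discarded. -/
noncomputable def cells {n k T : ℕ} (hk : k ≤ n) (L : ℕ) (ω : Outcome n k T) :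
    ℕ → Fin k → Fin n
  | 0 => Fin.castLE hk
  | a + 1 =>
    if h : k + a < n then
      let i : Fin n := ⟨k + a, h⟩
      let c : Fin k := ω.2 i
      if exploreMean L ω (cells hk L ω a c) < exploreMean L ω i then
        Function.update (cells hk L ω a) c i
      else cells hk L ω a
    else cells hk L ω a

/-- The set of arms in the cells. -/
noncomputable def stored {n k T : ℕ} (hk : k ≤ n) (L : ℕ) (ω : Outcome n k T) (a : ℕ) :
    Finset (Fin n) :=
  Finset.univ.image (cells hk L ω a)

/-- The set of arms retained at the end of the stream. -/
noncomputable def finalArms {n k T : ℕ} (hk : k ≤ n) (L : ℕ) (ω : Outcome n k T) :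
    Finset (Fin n) :=
  stored hk L ω (n - k)

/-! ### The exploitation phase: UCB with parameter `δ` -/

/-- The upper confidence bound of an arm which UCB has pulled `N` times with sum of rewards `S`. -/
noncomputable def ucbIndex (δ : ℝ) (N : ℕ) (S : ℝ) : EReal :=
  if N = 0 then ⊤ else ((S / N + √(2 * Real.log (1 / δ) / N) : ℝ) : EReal)

/-- The upper confidence bound of arm `i` when `N i` is the number of its pulls by UCB. These pulls
come after the `L` pulls of the exploration phase, and UCB uses their rewards only. -/
noncomputable def ucbOf {n k T : ℕ} (L : ℕ) (δ : ℝ) (ω : Outcome n k T) (N : Fin n → ℕ)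
    (i : Fin n) : EReal :=
  ucbIndex δ (N i) (∑ s ∈ Finset.range (N i), reward ω i (L + s))

open Classical in
/-- The arms of `M` with the largest upper confidence bound. -/
noncomputable def ucbArgmax {n k T : ℕ} (L : ℕ) (δ : ℝ) (ω : Outcome n k T) (M : Finset (Fin n))
    (N : Fin n → ℕ) : Finset (Fin n) :=
  M.filter fun i => ∀ j ∈ M, ucbOf L δ ω N j ≤ ucbOf L δ ω N i

/-- The numbers of pulls of the arms in the first `u` rounds of UCB on the retained arms. In round
`u` of UCB, `tie u` selects one arm among those with the largest upper confidence bound. -/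
noncomputable def ucbCount {n k T : ℕ} (hk : k ≤ n) (L : ℕ) (δ : ℝ)
    (tie : ℕ → Finset (Fin n) → Fin n) (ω : Outcome n k T) : ℕ → Fin n → ℕ
  | 0 => 0
  | u + 1 =>
    let N := ucbCount hk L δ tie ω u
    N + Pi.single (tie u (ucbArgmax L δ ω (finalArms hk L ω) N)) 1

/-- The arm pulled in round `u` of UCB. -/
noncomputable def ucbArm {n k T : ℕ} (hk : k ≤ n) (L : ℕ) (δ : ℝ)
    (tie : ℕ → Finset (Fin n) → Fin n) (ω : Outcome n k T) (u : ℕ) : Fin n :=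
  tie u (ucbArgmax L δ ω (finalArms hk L ω) (ucbCount hk L δ tie ω u))

/-! ### The whole algorithm, round by round (rounds are counted from `0`) -/

/-- The arm pulled in round `t`: arm `t / L` while `t < L * n`, and then the arm chosen by UCB. -/
noncomputable def pulledArm {n k T : ℕ} (hk : k ≤ n) (L : ℕ) (δ : ℝ)
    (tie : ℕ → Finset (Fin n) → Fin n) (ω : Outcome n k T) (t : ℕ) : Fin n :=
  if h : t < L * n then ⟨t / L, Nat.div_lt_of_lt_mul h⟩
  else ucbArm hk L δ tie ω (t - L * n)

open Classical in
/-- The arms in memory when the pull of round `t` is made: the first `k` arms while these are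
explored, then the cells and the incoming arm, and finally the retained arms. -/
noncomputable def memoryAt {n k T : ℕ} (hk : k ≤ n) (L : ℕ) (ω : Outcome n k T) (t : ℕ) :
    Finset (Fin n) :=
  if h : t < L * n then
    if t / L < k then stored hk L ω 0
    else insert ⟨t / L, Nat.div_lt_of_lt_mul h⟩ (stored hk L ω (t / L - k))
  else finalArms hk L ω

/-- The single-pass streaming discipline with memory size `m`, for a game of `T` rounds in which
`mem t` is the set of arms in memory and `A t` is the pulled arm of round `t`: at most `m` arms are
in memory, the pulled arm is in memory, and an arm enters the memory only when it is read from the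
stream, which happens once for each arm and in the order of arrival. Here `pos t` is the number of
arms of the stream that have been read up to the pull of round `t`. -/
def IsSinglePass {n : ℕ} (m T : ℕ) (mem : ℕ → Finset (Fin n)) (A : ℕ → Fin n) : Prop :=
  (∀ t < T, (mem t).card ≤ m ∧ A t ∈ mem t) ∧
  ∃ pos : ℕ → ℕ, Monotone pos ∧
    (∀ t < T, ∀ i ∈ mem t, (i : ℕ) < pos t) ∧
    (∀ t, t + 1 < T → ∀ i ∈ mem (t + 1), i ∈ mem t ∨ pos t ≤ (i : ℕ))

/-- The number of exploration pulls per arm, `(2α/e)^(α/(α+1)) * (T/m)^(1/(α+1))` rounded up. -/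
noncomputable def explorePulls (α : ℝ) (m T : ℕ) : ℕ :=
  ⌈(2 * α / Real.exp 1) ^ (α / (α + 1)) * ((T : ℝ) / m) ^ (1 / (α + 1))⌉₊

/-- There are at least `m - 1` arms to fill the cells. -/
theorem pred_le_of_small {m n : ℕ} (h : 3 * m < 2 * n) : m - 1 ≤ n := by omega

end StreamingBandit

/-!
The empirical mean of an arm is computed once and never updated, so the empirical mean of the
occupant of a cell can only grow. Fix a best arm `b` and look at the occupant `i ≠ b`, at the end of
the stream, of the cell for which `b` competed (`survivor`). It competed for the same cell as `b`,
and its empirical mean is at least that of `b`. The first event depends only on the choices of cells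
and has probability at most `1 / k`, where `k = m - 1`; the second depends only on the rewards and
has probability at most `2 * exp (-L * Δᵢ ^ 2 / 2)` by Hoeffding's inequality
(`law_real_survivor_eq_le`). In this way there is no need to follow the chain of replacements, and
the expected gap of the survivor is at most `∑ᵢ Δᵢ * 2 * exp (-L * Δᵢ ^ 2 / 2) / k`.

UCB is compared with this survivor `j`. On the event that all averages of UCB rewards of all arms
stay within their confidence intervals, the arms with gap at most `2 * Δⱼ` cost at most `2 * T * Δⱼ`,
while any other retained arm is pulled `O(log (1 / δ) / Δᵢ ^ 2)` times
(`regret_le_of_concentrated`). The event involves all arms, retained or not, so the dependence of the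
retained set on the rewards is harmless, and it fails with probability at most `2 * n * T * δ ^ 4`.

The number of exploration pulls is at least `B = (2α/e)^(α/(α+1)) * (T/m)^(1/(α+1))`, the solution of
`B ^ (α + 1) = (2α/e) ^ α * T / m`; with `e * z ≤ exp z` this gives
`T / m * exp (-L * Δ ^ 2 / 2) ≤ B * Δ ^ (-2α)` (`mul_exp_neg_le_exploreScale`). All remaining terms
are at most a constant times `B * ∑ᵢ Δᵢ ^ (1 - 2α)` for large `T`, because `Δ` and `1 / Δ` are at most
`Δ ^ (1 - 2α)` for `0 < Δ ≤ 1`.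
-/

namespace StreamingBandit

open MeasureTheory ProbabilityTheory

/-! ### The exploration phase and the memory discipline -/

/-- The cell for which arm `i` competes: its own one if it is among the first `k` arms, and otherwise
the one drawn at its arrival. -/
def assignedCell {n k : ℕ} (c : Fin n → Fin k) (i : Fin n) : Fin k :=
  if h : (i : ℕ) < k then ⟨i, h⟩ else c i

lemma cells_lt {n k T : ℕ} (hk : k ≤ n) (L : ℕ) (ω : Outcome n k T) (a : ℕ) (j : Fin k) :
    (cells hk L ω a j : ℕ) < k + a := by
  induction a with
  | zero => simp [cells]
  | succ a ih =>
    simp only [cells]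
    split_ifs with h1 h2
    · rw [Function.update_apply]
      split_ifs
      · simp
      · omega
    all_goals omega

lemma assignedCell_cells {n k T : ℕ} (hk : k ≤ n) (L : ℕ) (ω : Outcome n k T) (a : ℕ)
    (j : Fin k) : assignedCell ω.2 (cells hk L ω a j) = j := by
  induction a with
  | zero => simp [cells, assignedCell]
  | succ a ih =>
    simp only [cells]
    split_ifs with h1 h2
    · rw [Function.update_apply]
      split_ifs with h3
      · simp [assignedCell, h3]
      · exact ih
    all_goals exact ih

lemma exploreMean_cells_le_succ {n k T : ℕ} (hk : k ≤ n) (L : ℕ) (ω : Outcome n k T) (a : ℕ)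
    (j : Fin k) :
    exploreMean L ω (cells hk L ω a j) ≤ exploreMean L ω (cells hk L ω (a + 1) j) := by
  simp only [cells]
  split_ifs with h1 h2
  · rw [Function.update_apply]
    split_ifs with h3
    · rw [h3]; exact h2.le
    · exact le_rfl
  all_goals exact le_rfl

/-- Empirical means are computed only once, so the empirical mean of the occupant of a cell never
decreases. Hence an arm never outranks the occupant of the cell for which it has competed. -/
lemma exploreMean_le_cells_assignedCell {n k T : ℕ} (hk : k ≤ n) (L : ℕ) (ω : Outcome n k T)
    (a : ℕ) (i : Fin n) (hi : (i : ℕ) < k + a) :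
    exploreMean L ω i ≤ exploreMean L ω (cells hk L ω a (assignedCell ω.2 i)) := by
  induction a with
  | zero =>
    have h : (i : ℕ) < k := by simpa using hi
    simp [cells, assignedCell, h]
  | succ a ih =>
    by_cases h : (i : ℕ) < k + a
    · exact (ih h).trans (exploreMean_cells_le_succ hk L ω a _)
    · have hia : (i : ℕ) = k + a := by omega
      have hn : k + a < n := hia ▸ i.2
      have hi' : (⟨k + a, hn⟩ : Fin n) = i := Fin.ext hia.symm
      have hc : assignedCell ω.2 i = ω.2 i := by simp [assignedCell, hia]
      rw [hc]
      simp only [cells, hn, dif_pos, hi']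
      split_ifs with h2
      · simp
      · exact not_lt.1 h2

lemma mem_stored_lt {n k T : ℕ} {hk : k ≤ n} {L : ℕ} {ω : Outcome n k T} {a : ℕ} {i : Fin n}
    (hi : i ∈ stored hk L ω a) : (i : ℕ) < k + a := by
  obtain ⟨j, -, rfl⟩ := Finset.mem_image.1 hi
  exact cells_lt hk L ω a j

lemma card_stored_le {n k T : ℕ} (hk : k ≤ n) (L : ℕ) (ω : Outcome n k T) (a : ℕ) :
    (stored hk L ω a).card ≤ k :=
  Finset.card_image_le.trans (by simp)

lemma mem_stored_succ {n k T : ℕ} {hk : k ≤ n} {L : ℕ} {ω : Outcome n k T} {a : ℕ} {i : Fin n}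
    (hi : i ∈ stored hk L ω (a + 1)) : i ∈ stored hk L ω a ∨ (i : ℕ) = k + a := by
  obtain ⟨j, -, rfl⟩ := Finset.mem_image.1 hi
  have old (j : Fin k) : cells hk L ω a j ∈ stored hk L ω a :=
    Finset.mem_image_of_mem _ (Finset.mem_univ j)
  simp only [cells]
  split_ifs with h1 h2
  · rw [Function.update_apply]
    split_ifs
    · exact Or.inr rfl
    · exact Or.inl (old j)
  all_goals exact Or.inl (old j)

lemma stored_zero_mem {n k T : ℕ} (hk : k ≤ n) (L : ℕ) (ω : Outcome n k T) (i : Fin n)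
    (hi : (i : ℕ) < k) : i ∈ stored hk L ω 0 :=
  Finset.mem_image.2 ⟨⟨i, hi⟩, Finset.mem_univ _, by ext; simp [cells]⟩

lemma cells_mem_finalArms {n k T : ℕ} (hk : k ≤ n) (L : ℕ) (ω : Outcome n k T) (j : Fin k) :
    cells hk L ω (n - k) j ∈ finalArms hk L ω :=
  Finset.mem_image_of_mem _ (Finset.mem_univ j)

lemma ucbArgmax_nonempty {n k T : ℕ} (L : ℕ) (δ : ℝ) (ω : Outcome n k T) {M : Finset (Fin n)}
    (hM : M.Nonempty) (N : Fin n → ℕ) : (ucbArgmax L δ ω M N).Nonempty := by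
  obtain ⟨i, hi, hmax⟩ := M.exists_max_image (ucbOf L δ ω N) hM
  exact ⟨i, Finset.mem_filter.2 ⟨hi, hmax⟩⟩

lemma ucbArm_mem_ucbArgmax {n k T : ℕ} (hk : k ≤ n) (hk0 : 0 < k) (L : ℕ) (δ : ℝ)
    {tie : ℕ → Finset (Fin n) → Fin n} (htie : ∀ u S, S.Nonempty → tie u S ∈ S)
    (ω : Outcome n k T) (u : ℕ) :
    ucbArm hk L δ tie ω u ∈
      ucbArgmax L δ ω (finalArms hk L ω) (ucbCount hk L δ tie ω u) :=
  htie _ _ (ucbArgmax_nonempty L δ ω ⟨_, cells_mem_finalArms hk L ω ⟨0, hk0⟩⟩ _)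

theorem isSinglePass_memoryAt {n k T : ℕ} (hk : k ≤ n) (hk0 : 0 < k) (hkn : k < n) (L : ℕ) (δ : ℝ)
    {tie : ℕ → Finset (Fin n) → Fin n} (htie : ∀ u S, S.Nonempty → tie u S ∈ S)
    (ω : Outcome n k T) :
    IsSinglePass (k + 1) T (memoryAt hk L ω) (pulledArm hk L δ tie ω) := by
  refine ⟨fun t _ => ⟨?_, ?_⟩,
    fun t => if t < L * n then (if t / L < k then k else t / L + 1) else n, ?_, ?_, ?_⟩
  · unfold memoryAt
    split_ifs
    · exact (card_stored_le hk L ω _).trans (Nat.le_succ k)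
    · exact (Finset.card_insert_le _ _).trans (Nat.succ_le_succ (card_stored_le hk L ω _))
    · exact (card_stored_le hk L ω _).trans (Nat.le_succ k)
  · unfold memoryAt pulledArm
    split_ifs with h1 h2
    · exact stored_zero_mem hk L ω _ h2
    · exact Finset.mem_insert_self _ _
    · exact (Finset.mem_filter.1 (ucbArm_mem_ucbArgmax hk hk0 L δ htie ω _)).1
  · intro s t hst
    have hdiv : s / L ≤ t / L := Nat.div_le_div_right hst
    have hlt : s < L * n → s / L < n := fun h => Nat.div_lt_of_lt_mul h
    have hlt' : t < L * n → t / L < n := fun h => Nat.div_lt_of_lt_mul h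
    dsimp only
    split_ifs <;> grind
  · intro t _ i hi
    dsimp only
    unfold memoryAt at hi
    split_ifs at hi ⊢ with h1 h2
    · simpa using mem_stored_lt hi
    · rcases Finset.mem_insert.1 hi with rfl | hi
      · simp
      · have := mem_stored_lt hi
        omega
    · exact i.2
  · intro t _ i hi
    dsimp only
    by_cases hL : L = 0
    · subst hL
      simp only [memoryAt, zero_mul, not_lt_zero, dif_neg, not_false_eq_true] at hi ⊢
      exact Or.inl hi
    have hL0 : 0 < L := Nat.pos_of_ne_zero hL
    by_cases h1 : t + 1 < L * n
    · have h0 : t < L * n := by omega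
      simp only [memoryAt, h1, h0, dif_pos, if_true] at hi ⊢
      have hstep : (t + 1) / L = t / L ∨ (t + 1) / L = t / L + 1 := by
        rw [Nat.succ_div]; split_ifs <;> simp
      rcases hstep with hq | hq
      · simp only [hq] at hi
        exact Or.inl hi
      · simp only [hq] at hi
        by_cases h2 : t / L + 1 < k
        · rw [if_pos h2] at hi
          rw [if_pos (by omega)]
          exact Or.inl hi
        · rw [if_neg h2] at hi
          rcases Finset.mem_insert.1 hi with rfl | hi
          · right
            split_ifs <;> simp; omega
          · by_cases h3 : t / L < k
            · rw [if_pos h3]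
              left
              have : t / L + 1 - k = 0 := by omega
              rwa [this] at hi
            · rw [if_neg h3]
              left
              have : t / L + 1 - k = (t / L - k) + 1 := by omega
              rw [this] at hi
              rcases mem_stored_succ hi with h | h
              · exact Finset.mem_insert_of_mem h
              · exact Finset.mem_insert.2 (Or.inl (Fin.ext (by simp; omega)))
    · by_cases h0 : t < L * n
      · have ht : t + 1 = L * n := by omega
        have hq : t / L = n - 1 := by
          have hn : L * n = L * (n - 1) + L := by
            rw [← Nat.mul_succ]; congr 1; omega
          rw [Nat.div_eq_iff hL0]
          constructor
          · rw [mul_comm]; omega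
          · rw [mul_comm]; omega
        simp only [memoryAt, h1, h0, dif_pos, dif_neg, not_false_eq_true, hq] at hi ⊢
        left
        rw [if_neg (by omega)]
        have : n - k = (n - 1 - k) + 1 := by omega
        rw [finalArms, this] at hi
        rcases mem_stored_succ hi with h | h
        · exact Finset.mem_insert_of_mem h
        · exact Finset.mem_insert.2 (Or.inl (Fin.ext (by simp; omega)))
      · simp only [memoryAt, h1, h0, dif_neg, not_false_eq_true] at hi ⊢
        exact Or.inl hi

/-! ### Gaps and the number of UCB pulls -/

lemma le_bestMean {n : ℕ} (μ : Fin n → unitInterval) (i : Fin n) : (μ i : ℝ) ≤ bestMean μ :=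
  le_ciSup (f := fun j => (μ j : ℝ)) (Set.finite_range _).bddAbove i

lemma gap_nonneg {n : ℕ} (μ : Fin n → unitInterval) (i : Fin n) : 0 ≤ gap μ i :=
  sub_nonneg.2 (le_bestMean μ i)

lemma exists_gap_eq_zero {n : ℕ} (hn : 0 < n) (μ : Fin n → unitInterval) : ∃ i, gap μ i = 0 := by
  have : Nonempty (Fin n) := ⟨⟨0, hn⟩⟩
  obtain ⟨i, hi⟩ := exists_eq_ciSup_of_finite (f := fun j => (μ j : ℝ))
  exact ⟨i, by simp only [gap, bestMean]; rw [← hi]; simp⟩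

lemma gap_le_one {n : ℕ} (μ : Fin n → unitInterval) (i : Fin n) : gap μ i ≤ 1 := by
  obtain ⟨j, hj⟩ := exists_gap_eq_zero (i.pos) μ
  have h1 := (μ j).2.2
  have h0 := (μ i).2.1
  simp only [gap] at hj ⊢
  linarith

/-- The radius of the confidence interval of UCB after `N` pulls. -/
noncomputable def confRadius (δ : ℝ) (N : ℕ) : ℝ :=
  √(2 * Real.log (1 / δ) / N)

/-- The event that every average of UCB rewards stays within its confidence interval. It involves
all arms of the stream, so that it does not depend on the outcome of the exploration phase. -/
def Concentrated {n k T : ℕ} (μ : Fin n → unitInterval) (L : ℕ) (δ : ℝ) (ω : Outcome n k T) :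
    Prop :=
  ∀ (i : Fin n) (N : ℕ), 1 ≤ N → L + N ≤ T →
    |∑ s ∈ Finset.range N, reward ω i (L + s) - N * μ i| ≤ N * confRadius δ N

lemma abs_div_sub_le_of_abs_sub_mul_le {S N m w : ℝ} (hN : 0 < N) (h : |S - N * m| ≤ N * w) :
    |S / N - m| ≤ w := by
  have : S - N * m = N * (S / N - m) := by field_simp
  rw [this, abs_mul, abs_of_pos hN] at h
  exact le_of_mul_le_mul_left h hN

lemma sum_ucbCount {n k T : ℕ} (hk : k ≤ n) (L : ℕ) (δ : ℝ)
    (tie : ℕ → Finset (Fin n) → Fin n) (ω : Outcome n k T) (u : ℕ) :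
    ∑ i, ucbCount hk L δ tie ω u i = u := by
  induction u with
  | zero => simp [ucbCount]
  | succ u ih => simp [ucbCount, Finset.sum_add_distrib, ih]

lemma ucbCount_le {n k T : ℕ} (hk : k ≤ n) (L : ℕ) (δ : ℝ)
    (tie : ℕ → Finset (Fin n) → Fin n) (ω : Outcome n k T) (u : ℕ) (i : Fin n) :
    ucbCount hk L δ tie ω u i ≤ u := by
  calc ucbCount hk L δ tie ω u i ≤ ∑ i, ucbCount hk L δ tie ω u i :=
        Finset.single_le_sum (fun _ _ => Nat.zero_le _) (Finset.mem_univ i)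
    _ = u := sum_ucbCount hk L δ tie ω u

lemma ucbCount_succ {n k T : ℕ} (hk : k ≤ n) (L : ℕ) (δ : ℝ)
    (tie : ℕ → Finset (Fin n) → Fin n) (ω : Outcome n k T) (u : ℕ) (i : Fin n) :
    ucbCount hk L δ tie ω (u + 1) i =
      ucbCount hk L δ tie ω u i + if i = ucbArm hk L δ tie ω u then 1 else 0 := by
  simp only [ucbCount, ucbArm, Pi.add_apply, Pi.single_apply]
  congr

/-- An arm whose UCB index is maximal after `N ≥ 1` of its pulls has a confidence interval
whose radius is at least half its distance to any better retained arm. -/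
lemma mul_le_of_mem_ucbArgmax {n k T : ℕ} {μ : Fin n → unitInterval} {L : ℕ} {δ : ℝ}
    {ω : Outcome n k T} (hω : Concentrated μ L δ ω) (hδ : 0 ≤ Real.log (1 / δ))
    {M : Finset (Fin n)} {N : Fin n → ℕ} {i j : Fin n} (hN : ∀ i, L + N i ≤ T)
    (hi : i ∈ ucbArgmax L δ ω M N) (hj : j ∈ M) (hNi : 1 ≤ N i) (hij : (μ i : ℝ) < μ j) :
    N i * ((μ j : ℝ) - μ i) ^ 2 ≤ 8 * Real.log (1 / δ) := by
  have hidx := (Finset.mem_filter.1 hi).2 j hj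
  have hNj : N j ≠ 0 := by
    intro h0
    simp [ucbOf, ucbIndex, h0, Nat.one_le_iff_ne_zero.1 hNi, -EReal.coe_add] at hidx
  have hNi' : N i ≠ 0 := by omega
  simp only [ucbOf, ucbIndex, hNj, hNi', if_false, EReal.coe_le_coe_iff] at hidx
  have hNi0 : (0 : ℝ) < N i := by exact_mod_cast hNi
  have hNj0 : (0 : ℝ) < N j := by exact_mod_cast Nat.pos_of_ne_zero hNj
  have ci := abs_le.1 (abs_div_sub_le_of_abs_sub_mul_le hNi0 (hω i (N i) hNi (hN i)))
  have cj := abs_le.1 (abs_div_sub_le_of_abs_sub_mul_le hNj0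
    (hω j (N j) (Nat.one_le_iff_ne_zero.2 hNj) (hN j)))
  simp only [confRadius] at ci cj
  have hle : (μ j : ℝ) - μ i ≤ 2 * √(2 * Real.log (1 / δ) / N i) := by
    linarith [ci.2, cj.1]
  have hsq : ((μ j : ℝ) - μ i) ^ 2 ≤ 4 * (2 * Real.log (1 / δ) / N i) := by
    calc ((μ j : ℝ) - μ i) ^ 2 ≤ (2 * √(2 * Real.log (1 / δ) / N i)) ^ 2 :=
          pow_le_pow_left₀ (by linarith) hle 2
      _ = _ := by rw [mul_pow, Real.sq_sqrt (by positivity)]; norm_num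
  calc N i * ((μ j : ℝ) - μ i) ^ 2 ≤ N i * (4 * (2 * Real.log (1 / δ) / N i)) := by gcongr
    _ = _ := by field_simp; ring

lemma ucbCount_le_of_lt {n k T : ℕ} (hk : k ≤ n) (hk0 : 0 < k) {L : ℕ} {δ : ℝ}
    {tie : ℕ → Finset (Fin n) → Fin n} (htie : ∀ u S, S.Nonempty → tie u S ∈ S)
    {μ : Fin n → unitInterval} {ω : Outcome n k T} (hω : Concentrated μ L δ ω)
    (hδ : 0 ≤ Real.log (1 / δ)) {i j : Fin n} (hj : j ∈ finalArms hk L ω)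
    (hij : (μ i : ℝ) < μ j) (u : ℕ) (hu : L + u ≤ T) :
    (ucbCount hk L δ tie ω u i : ℝ) ≤ 1 + 8 * Real.log (1 / δ) / ((μ j : ℝ) - μ i) ^ 2 := by
  have hpos : 0 < ((μ j : ℝ) - μ i) ^ 2 := pow_pos (sub_pos.2 hij) 2
  induction u with
  | zero =>
    simp only [ucbCount, Pi.zero_apply, Nat.cast_zero]
    positivity
  | succ u ih =>
    rw [ucbCount_succ]
    split_ifs with hpull
    · push_cast
      rw [add_comm]
      gcongr
      rcases Nat.eq_zero_or_pos (ucbCount hk L δ tie ω u i) with h0 | h0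
      · rw [h0, Nat.cast_zero]; positivity
      · rw [le_div_iff₀ hpos]
        refine mul_le_of_mem_ucbArgmax hω hδ
          (fun i' => (Nat.add_le_add_left (ucbCount_le hk L δ tie ω u i') L).trans (by omega))
          ?_ hj h0 hij
        rw [hpull]
        exact ucbArm_mem_ucbArgmax hk hk0 L δ htie ω u
    · simpa using ih (by omega)

/-! ### Pathwise regret bounds -/

lemma sum_gap_ucbArm {n k T : ℕ} (hk : k ≤ n) (L : ℕ) (δ : ℝ)
    (tie : ℕ → Finset (Fin n) → Fin n) (μ : Fin n → unitInterval) (ω : Outcome n k T) (U : ℕ) :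
    ∑ u ∈ Finset.range U, gap μ (ucbArm hk L δ tie ω u) =
      ∑ i, gap μ i * ucbCount hk L δ tie ω U i := by
  induction U with
  | zero => simp [ucbCount]
  | succ U ih =>
    rw [Finset.sum_range_succ, ih]
    simp [ucbCount_succ, mul_add, Finset.sum_add_distrib]

lemma sum_range_mul_div (g : ℕ → ℝ) {L : ℕ} (hL : 0 < L) (n : ℕ) :
    ∑ t ∈ Finset.range (L * n), g (t / L) = L * ∑ i ∈ Finset.range n, g i := by
  induction n with
  | zero => simp
  | succ n ih =>
    rw [Nat.mul_succ, Finset.sum_range_add, ih, Finset.sum_range_succ, mul_add]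
    congr 1
    rw [Finset.sum_congr rfl (g := fun _ => g n)]
    · simp
    · intro x hx
      rw [Nat.mul_add_div hL, Nat.div_eq_of_lt (Finset.mem_range.1 hx), add_zero]

lemma regret_pulledArm {n k T : ℕ} (hk : k ≤ n) {L : ℕ} (hL : 0 < L) (δ : ℝ)
    (tie : ℕ → Finset (Fin n) → Fin n) (μ : Fin n → unitInterval) (ω : Outcome n k T)
    (hT : L * n ≤ T) :
    regret μ T (pulledArm hk L δ tie ω) =
      L * ∑ i, gap μ i + ∑ i, gap μ i * ucbCount hk L δ tie ω (T - L * n) i := by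
  have hsplit : T = L * n + (T - L * n) := by omega
  have hreg : regret μ T (pulledArm hk L δ tie ω) =
      ∑ t ∈ Finset.range (L * n + (T - L * n)), gap μ (pulledArm hk L δ tie ω t) := by
    rw [← hsplit]; rfl
  rw [hreg, Finset.sum_range_add, ← sum_gap_ucbArm]
  congr 1
  · have hsum : ∑ i, gap μ i =
        ∑ i ∈ Finset.range n, (fun q => if h : q < n then gap μ ⟨q, h⟩ else 0) i := by
      rw [Finset.sum_range]; simp
    rw [hsum, ← sum_range_mul_div _ hL]
    refine Finset.sum_congr rfl fun t ht => ?_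
    have ht' := Finset.mem_range.1 ht
    simp [pulledArm, ht', Nat.div_lt_of_lt_mul ht']
  · refine Finset.sum_congr rfl fun u _ => ?_
    simp [pulledArm]

lemma regret_le_mul_sum_gap {n : ℕ} (μ : Fin n → unitInterval) (T : ℕ) (A : ℕ → Fin n) :
    regret μ T A ≤ T * ∑ i, gap μ i := by
  calc regret μ T A ≤ ∑ _t ∈ Finset.range T, ∑ i, gap μ i :=
        Finset.sum_le_sum fun t _ => Finset.single_le_sum (f := gap μ)
          (fun i _ => gap_nonneg μ i) (Finset.mem_univ (A t))
    _ = _ := by simp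

lemma sum_filter_gap_pos {n : ℕ} (μ : Fin n → unitInterval) (f : Fin n → ℝ) :
    ∑ i with 0 < gap μ i, gap μ i * f i = ∑ i, gap μ i * f i := by
  refine Finset.sum_filter_of_ne fun i _ h => ?_
  exact (gap_nonneg μ i).lt_of_ne fun h0 => h (by rw [← h0, zero_mul])

/-- UCB competes with any retained arm `j`: arms with at most twice the gap of `j` are charged
to `j`, and all others are far enough from `j` for their pulls to be few. -/
lemma regret_le_of_concentrated {n k T : ℕ} (hk : k ≤ n) (hk0 : 0 < k) {L : ℕ} (hL : 0 < L) {δ : ℝ}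
    {tie : ℕ → Finset (Fin n) → Fin n} (htie : ∀ u S, S.Nonempty → tie u S ∈ S)
    {μ : Fin n → unitInterval} {ω : Outcome n k T} (hω : Concentrated μ L δ ω)
    (hδ : 0 ≤ Real.log (1 / δ)) (hT : L * n ≤ T) {j : Fin n} (hj : j ∈ finalArms hk L ω) :
    regret μ T (pulledArm hk L δ tie ω) ≤ L * ∑ i, gap μ i + 2 * T * gap μ j +
      ∑ i with 0 < gap μ i, (gap μ i + 32 * Real.log (1 / δ) / gap μ i) := by
  rw [regret_pulledArm hk hL δ tie μ ω hT, add_assoc]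
  gcongr
  set N := ucbCount hk L δ tie ω (T - L * n) with hNdef
  have hu : L + (T - L * n) ≤ T := by
    have : L * 1 ≤ L * n := Nat.mul_le_mul_left L j.pos
    omega
  have hterm (i : Fin n) : gap μ i * N i ≤ 2 * gap μ j * N i +
      if 0 < gap μ i then gap μ i + 32 * Real.log (1 / δ) / gap μ i else 0 := by
    have hi0 := gap_nonneg μ i
    have hj0 := gap_nonneg μ j
    by_cases h : gap μ i ≤ 2 * gap μ j
    · have h1 : gap μ i * N i ≤ 2 * gap μ j * N i := by gcongr
      split_ifs
      · have : 0 ≤ gap μ i + 32 * Real.log (1 / δ) / gap μ i := by positivity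
        linarith
      · linarith
    · push Not at h
      have hi : 0 < gap μ i := by linarith
      have hdiff : gap μ i / 2 ≤ (μ j : ℝ) - μ i := by simp only [gap] at h ⊢; linarith
      have hc := ucbCount_le_of_lt hk hk0 htie hω hδ hj (i := i) (by linarith) _ hu
      rw [← hNdef] at hc
      have hb : 8 * Real.log (1 / δ) / ((μ j : ℝ) - μ i) ^ 2 ≤
          8 * Real.log (1 / δ) / (gap μ i / 2) ^ 2 := by gcongr
      rw [if_pos hi]
      have h2 : gap μ i * N i ≤ gap μ i * (1 + 8 * Real.log (1 / δ) / (gap μ i / 2) ^ 2) := by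
        gcongr; linarith
      have h3 : gap μ i * (1 + 8 * Real.log (1 / δ) / (gap μ i / 2) ^ 2) =
          gap μ i + 32 * Real.log (1 / δ) / gap μ i := by field_simp; ring
      have h4 : 0 ≤ 2 * gap μ j * N i := by positivity
      linarith
  calc ∑ i, gap μ i * N i ≤ ∑ i, (2 * gap μ j * N i +
        if 0 < gap μ i then gap μ i + 32 * Real.log (1 / δ) / gap μ i else 0) :=
        Finset.sum_le_sum fun i _ => hterm i
    _ = 2 * gap μ j * (∑ i, N i : ℕ) +
        ∑ i with 0 < gap μ i, (gap μ i + 32 * Real.log (1 / δ) / gap μ i) := by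
      rw [Finset.sum_add_distrib, ← Finset.mul_sum, Finset.sum_filter]; push_cast; rfl
    _ ≤ _ := by
      gcongr ?_ + _
      rw [hNdef, sum_ucbCount]
      have : ((T - L * n : ℕ) : ℝ) ≤ T := by exact_mod_cast Nat.sub_le _ _
      nlinarith [gap_nonneg μ j]

/-! ### Concentration of the rewards -/

instance isProbabilityMeasure_law {n k T : ℕ} [NeZero k] (μ : Fin n → unitInterval) :
    IsProbabilityMeasure (law k T μ) := by
  unfold law; infer_instance

/-- The centred rewards, indexed by arm and pull number. -/
noncomputable def centeredReward {n T : ℕ} (μ : Fin n → unitInterval) (p : Fin n × Fin T)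
    (x : Fin n × Fin T → Bool) : ℝ :=
  (if x p then 1 else 0) - μ p.1

/-- The law of the reward lists. -/
noncomputable abbrev rewardLaw {n : ℕ} (T : ℕ) (μ : Fin n → unitInterval) :
    Measure (Fin n × Fin T → Bool) :=
  Measure.pi fun p => bernoulliMeasure true false (μ p.1)

lemma iIndepFun_centeredReward {n T : ℕ} (μ : Fin n → unitInterval) :
    iIndepFun (centeredReward (T := T) μ) (rewardLaw T μ) :=
  iIndepFun_pi (X := fun (p : Fin n × Fin T) (b : Bool) => (if b then (1 : ℝ) else 0) - μ p.1)
    fun _ => (measurable_of_finite _).aemeasurable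

lemma hasSubgaussianMGF_centeredReward {n T : ℕ} (μ : Fin n → unitInterval) (p : Fin n × Fin T) :
    HasSubgaussianMGF (centeredReward μ p) (1 / 4) (rewardLaw T μ) := by
  have h := hasSubgaussianMGF_of_mem_Icc (μ := bernoulliMeasure true false (μ p.1))
    (X := fun b : Bool => if b then (1 : ℝ) else 0) (a := 0) (b := 1)
    (measurable_of_finite _).aemeasurable
    (Filter.Eventually.of_forall fun b => by cases b <;> simp)
  have hint : ∫ b, (if b then (1 : ℝ) else 0) ∂(bernoulliMeasure true false (μ p.1)) = μ p.1 := by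
    simp [integral_bernoulliMeasure]
  rw [hint] at h
  have hmap := (measurePreserving_eval
    (fun p : Fin n × Fin T => bernoulliMeasure true false (μ p.1)) p)
  rw [← hmap.map_eq] at h
  have h2 := HasSubgaussianMGF.of_map hmap.measurable.aemeasurable h
  have hc : ((‖(1 : ℝ) - 0‖₊ / 2) ^ 2 : NNReal) = 1 / 4 := by
    simp; norm_num
  rw [hc] at h2
  exact h2

lemma law_real_fst {n k T : ℕ} [NeZero k] (μ : Fin n → unitInterval)
    (S : Set (Fin n × Fin T → Bool)) :
    (law k T μ).real {ω | ω.1 ∈ S} = (rewardLaw T μ).real S := by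
  have h : MeasurePreserving Prod.fst (law k T μ) (rewardLaw T μ) := by
    unfold law; exact measurePreserving_fst
  exact h.measureReal_preimage S.toFinite.measurableSet.nullMeasurableSet

lemma sum_reward_sub {n k T : ℕ} (μ : Fin n → unitInterval) (ω : Outcome n k T) (i : Fin n)
    {a N : ℕ} (h : a + N ≤ T) :
    ∑ s ∈ Finset.range N, reward ω i (a + s) - N * μ i =
      ∑ s : Fin N, centeredReward μ (i, (⟨a + s, by omega⟩ : Fin T)) ω.1 := by
  rw [Finset.sum_range]
  simp only [centeredReward, Finset.sum_sub_distrib]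
  simp only [Finset.sum_const, Finset.card_univ, Fintype.card_fin, nsmul_eq_mul]
  congr 1
  refine Finset.sum_congr rfl fun s _ => ?_
  have : a + (s : ℕ) < T := by omega
  simp [reward, this]

/-- Hoeffding's inequality for `N` successive rewards of an arm, upper tail. -/
lemma law_real_sum_reward_ge_le {n k T : ℕ} [NeZero k] (μ : Fin n → unitInterval) (i : Fin n)
    {a N : ℕ} (h : a + N ≤ T) {ε : ℝ} (hε : 0 ≤ ε) :
    (law k T μ).real {ω | ε ≤ ∑ s ∈ Finset.range N, reward ω i (a + s) - N * μ i} ≤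
      Real.exp (-(2 * ε ^ 2 / N)) := by
  simp only [sum_reward_sub μ _ i h]
  refine (law_real_fst μ {x | ε ≤ ∑ s : Fin N,
    centeredReward μ (i, (⟨a + s, by omega⟩ : Fin T)) x}).le.trans ?_
  have hinj : Function.Injective fun s : Fin N => (i, (⟨a + s, by omega⟩ : Fin T)) := by
    intro s t hst
    simp only [Prod.mk.injEq, Fin.mk.injEq, true_and] at hst
    exact Fin.ext (by omega)
  have := HasSubgaussianMGF.measure_sum_ge_le_of_iIndepFun
    ((iIndepFun_centeredReward (T := T) μ).precomp hinj) (s := Finset.univ)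
    (fun s _ => hasSubgaussianMGF_centeredReward μ _) hε
  refine this.trans (Real.exp_le_exp.2 (le_of_eq ?_))
  rcases Nat.eq_zero_or_pos N with rfl | hN
  · simp
  · simp; field_simp; norm_num

/-- Hoeffding's inequality for `N` successive rewards of an arm, lower tail. -/
lemma law_real_sum_reward_le_le {n k T : ℕ} [NeZero k] (μ : Fin n → unitInterval) (i : Fin n)
    {a N : ℕ} (h : a + N ≤ T) {ε : ℝ} (hε : 0 ≤ ε) :
    (law k T μ).real {ω | ∑ s ∈ Finset.range N, reward ω i (a + s) - N * μ i ≤ -ε} ≤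
      Real.exp (-(2 * ε ^ 2 / N)) := by
  have hneg : {ω : Outcome n k T | ∑ s ∈ Finset.range N, reward ω i (a + s) - N * μ i ≤ -ε} =
      {ω | ω.1 ∈ {x | ε ≤ ∑ s : Fin N,
        -centeredReward μ (i, (⟨a + s, by omega⟩ : Fin T)) x}} := by
    ext ω
    simp only [Set.mem_ofPred_eq, sum_reward_sub μ ω i h, Finset.sum_neg_distrib]
    exact le_neg
  rw [hneg, law_real_fst]
  have hinj : Function.Injective fun s : Fin N => (i, (⟨a + s, by omega⟩ : Fin T)) := by
    intro s t hst
    simp only [Prod.mk.injEq, Fin.mk.injEq, true_and] at hst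
    exact Fin.ext (by omega)
  have := HasSubgaussianMGF.measure_sum_ge_le_of_iIndepFun
    (((iIndepFun_centeredReward (T := T) μ).precomp hinj).comp (fun _ x => -x)
      fun _ => measurable_neg) (s := Finset.univ)
    (fun s _ => (hasSubgaussianMGF_centeredReward μ _).neg) hε
  refine this.trans (Real.exp_le_exp.2 (le_of_eq ?_))
  rcases Nat.eq_zero_or_pos N with rfl | hN
  · simp
  · simp; field_simp; norm_num

/-- The confidence radii make every single violation as unlikely as `δ ^ 4`. -/
lemma law_real_not_concentrated_le {n k T : ℕ} [NeZero k] (μ : Fin n → unitInterval) (L : ℕ)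
    {δ : ℝ} (hδ0 : 0 < δ) (hδ1 : δ ≤ 1) :
    (law k T μ).real {ω | ¬ Concentrated μ L δ ω} ≤ 2 * n * T * δ ^ 4 := by
  have hlog : 0 ≤ Real.log (1 / δ) := Real.log_nonneg (by rw [le_div_iff₀ hδ0]; linarith)
  have hsub : {ω : Outcome n k T | ¬ Concentrated μ L δ ω} ⊆
      ⋃ i ∈ (Finset.univ : Finset (Fin n)), ⋃ N ∈ (Finset.Icc 1 T).filter (L + · ≤ T),
        ({ω | N * confRadius δ N ≤ ∑ s ∈ Finset.range N, reward ω i (L + s) - N * μ i} ∪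
         {ω | ∑ s ∈ Finset.range N, reward ω i (L + s) - N * μ i ≤ -(N * confRadius δ N)}) := by
    intro ω hω
    simp only [Concentrated, Set.mem_ofPred_eq, not_forall, not_le] at hω
    obtain ⟨i, N, hN, hLN, h⟩ := hω
    simp only [Set.mem_iUnion, Finset.mem_filter, Finset.mem_Icc, Finset.mem_univ, exists_prop,
      true_and]
    refine ⟨i, N, ⟨⟨hN, by omega⟩, hLN⟩, ?_⟩
    rcases lt_abs.1 h with h | h
    · exact Or.inl h.le
    · exact Or.inr (by simp only [Set.mem_ofPred_eq]; linarith)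
  have hone (i : Fin n) (N : ℕ) (hN : N ∈ (Finset.Icc 1 T).filter (L + · ≤ T)) :
      (law k T μ).real
        ({ω | N * confRadius δ N ≤ ∑ s ∈ Finset.range N, reward ω i (L + s) - N * μ i} ∪
         {ω | ∑ s ∈ Finset.range N, reward ω i (L + s) - N * μ i ≤ -(N * confRadius δ N)}) ≤
      2 * δ ^ 4 := by
    simp only [Finset.mem_filter, Finset.mem_Icc] at hN
    have hN0 : (0 : ℝ) < N := by exact_mod_cast hN.1.1
    have hw : 0 ≤ N * confRadius δ N := mul_nonneg hN0.le (Real.sqrt_nonneg _)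
    have hexp : Real.exp (-(2 * (N * confRadius δ N) ^ 2 / N)) = δ ^ 4 := by
      rw [mul_pow, confRadius, Real.sq_sqrt (by positivity)]
      have : -(2 * ((N : ℝ) ^ 2 * (2 * Real.log (1 / δ) / N)) / N) = Real.log (δ ^ 4) := by
        rw [Real.log_pow, one_div, Real.log_inv]; field_simp; push_cast; ring
      rw [this, Real.exp_log (by positivity)]
    have h1 := law_real_sum_reward_ge_le (k := k) μ i hN.2 hw
    have h2 := law_real_sum_reward_le_le (k := k) μ i hN.2 hw
    rw [hexp] at h1 h2
    linarith [measureReal_union_le (μ := law k T μ)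
      {ω | N * confRadius δ N ≤ ∑ s ∈ Finset.range N, reward ω i (L + s) - N * μ i}
      {ω | ∑ s ∈ Finset.range N, reward ω i (L + s) - N * μ i ≤ -(N * confRadius δ N)}]
  have hcard : (((Finset.Icc 1 T).filter (L + · ≤ T)).card : ℝ) ≤ T := by
    have := Finset.card_filter_le (Finset.Icc 1 T) (L + · ≤ T)
    rw [Nat.card_Icc, Nat.add_sub_cancel] at this
    exact_mod_cast this
  calc (law k T μ).real {ω | ¬ Concentrated μ L δ ω}
      ≤ _ := measureReal_mono hsub (measure_ne_top _ _)
    _ ≤ _ := measureReal_biUnion_finset_le _ _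
    _ ≤ ∑ i : Fin n, ∑ N ∈ (Finset.Icc 1 T).filter (L + · ≤ T), 2 * δ ^ 4 :=
      Finset.sum_le_sum fun i _ =>
        (measureReal_biUnion_finset_le _ _).trans (Finset.sum_le_sum fun N hN => hone i N hN)
    _ = n * (((Finset.Icc 1 T).filter (L + · ≤ T)).card * (2 * δ ^ 4)) := by simp
    _ ≤ n * (T * (2 * δ ^ 4)) := by gcongr
    _ = _ := by ring

/-! ### The arm that survives in place of a best arm -/

/-- The arm that is retained in the cell for which arm `i` has competed. -/
noncomputable def survivor {n k T : ℕ} (hk : k ≤ n) (L : ℕ) (i : Fin n) (ω : Outcome n k T) :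
    Fin n :=
  cells hk L ω (n - k) (assignedCell ω.2 i)

lemma uniformOn_univ_real_singleton {k : ℕ} (v : Fin k) :
    (uniformOn (Set.univ : Set (Fin k))).real {v} = 1 / k := by
  simp [measureReal_def, uniformOn_univ]

/-- Two arms compete for the same cell with probability at most `1 / k`: two of the first `k` arms
never do, and otherwise one of the two cells is uniform and independent of the other. -/
lemma pi_uniformOn_real_assignedCell_eq_le {n k : ℕ} [NeZero k] {i j : Fin n} (hij : i ≠ j) :
    (Measure.pi fun _ : Fin n => uniformOn (Set.univ : Set (Fin k))).real
      {c | assignedCell c i = assignedCell c j} ≤ 1 / k := by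
  set P := Measure.pi fun _ : Fin n => uniformOn (Set.univ : Set (Fin k)) with hP
  have heval (i : Fin n) (v : Fin k) : P.real {c | c i = v} = 1 / k := by
    have h := (measurePreserving_eval (fun _ : Fin n => uniformOn (Set.univ : Set (Fin k))) i)
    rw [← uniformOn_univ_real_singleton v, ← h.measureReal_preimage
      (measurableSet_singleton v).nullMeasurableSet]
    rfl
  by_cases hi : (i : ℕ) < k <;> by_cases hj : (j : ℕ) < k
  · have : {c : Fin n → Fin k | assignedCell c i = assignedCell c j} = ∅ := by
      ext c
      have : (i : ℕ) ≠ j := fun h => hij (Fin.ext h)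
      simp [assignedCell, hi, hj, this]
    rw [this]; simp
  · have := heval j ⟨i, hi⟩
    simp only [assignedCell, hi, hj, dif_pos, dif_neg, not_false_eq_true]
    rw [← this]
    exact measureReal_mono fun c hc => Eq.symm hc
  · have := heval i ⟨j, hj⟩
    simp only [assignedCell, hi, hj, dif_pos, dif_neg, not_false_eq_true]
    exact this.le
  · simp only [assignedCell, hi, hj, dif_neg, not_false_eq_true]
    have hind : IndepFun (fun c : Fin n → Fin k => c i) (fun c => c j) P :=
      (iIndepFun_pi (X := fun (_ : Fin n) (v : Fin k) => v)
        fun _ => measurable_id.aemeasurable).indepFun hij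
    have hbox (v : Fin k) : P.real ({c | c i = v} ∩ {c | c j = v}) = 1 / k * (1 / k) := by
      have := hind.measure_inter_preimage_eq_mul {v} {v} (measurableSet_singleton v)
        (measurableSet_singleton v)
      calc P.real ({c | c i = v} ∩ {c | c j = v}) = P.real {c | c i = v} * P.real {c | c j = v} := by
            simp only [measureReal_def, ← ENNReal.toReal_mul]
            exact congrArg ENNReal.toReal this
        _ = _ := by rw [heval, heval]
    have hsub : {c : Fin n → Fin k | c i = c j} ⊆
        ⋃ v ∈ (Finset.univ : Finset (Fin k)), ({c | c i = v} ∩ {c | c j = v}) := by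
      intro c hc
      simp only [Set.mem_iUnion]
      exact ⟨c i, Finset.mem_univ _, rfl, Eq.symm hc⟩
    have hk : (k : ℝ) ≠ 0 := by exact_mod_cast NeZero.ne k
    calc P.real {c | c i = c j} ≤ _ := measureReal_mono hsub (measure_ne_top _ _)
      _ ≤ _ := measureReal_biUnion_finset_le _ _
      _ = 1 / k := by simp only [hbox]; simp; field_simp

/-- A best arm and an arm of gap `g` are misranked only if one of their empirical means is off by
at least `g / 2`. -/
lemma law_real_exploreMean_le_exploreMean_le {n k T : ℕ} [NeZero k] (μ : Fin n → unitInterval)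
    {L : ℕ} (hL : 0 < L) (hT : L ≤ T) {b : Fin n} (hb : gap μ b = 0) (i : Fin n) :
    (law k T μ).real {ω | exploreMean L ω b ≤ exploreMean L ω i} ≤
      2 * Real.exp (-(L * gap μ i ^ 2 / 2)) := by
  have hL0 : (0 : ℝ) < L := by exact_mod_cast hL
  have hε : 0 ≤ L * (gap μ i / 2) := mul_nonneg hL0.le (div_nonneg (gap_nonneg μ i) zero_le_two)
  have h1 := law_real_sum_reward_ge_le (k := k) (T := T) μ i (a := 0) (N := L) (by omega) hε
  have h2 := law_real_sum_reward_le_le (k := k) (T := T) μ b (a := 0) (N := L) (by omega) hε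
  have hexp : -(2 * (L * (gap μ i / 2)) ^ 2 / L) = -(L * gap μ i ^ 2 / 2) := by field_simp
  rw [hexp] at h1 h2
  simp only [zero_add] at h1 h2
  have hsub : {ω : Outcome n k T | exploreMean L ω b ≤ exploreMean L ω i} ⊆
      {ω | L * (gap μ i / 2) ≤ ∑ s ∈ Finset.range L, reward ω i s - L * μ i} ∪
      {ω | ∑ s ∈ Finset.range L, reward ω b s - L * μ b ≤ -(L * (gap μ i / 2))} := by
    intro ω hω
    simp only [Set.mem_ofPred_eq, exploreMean, div_le_div_iff_of_pos_right hL0] at hω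
    simp only [Set.mem_union, Set.mem_ofPred_eq]
    by_contra! hcon
    have hg : (μ b : ℝ) - μ i = gap μ i := by simp only [gap] at hb ⊢; linarith
    have : (L : ℝ) * μ b - L * μ i = L * gap μ i := by rw [← hg]; ring
    linarith [hcon.1, hcon.2]
  linarith [measureReal_mono (μ := law k T μ) hsub, measureReal_union_le (μ := law k T μ)
    {ω | L * (gap μ i / 2) ≤ ∑ s ∈ Finset.range L, reward ω i s - L * μ i}
    {ω | ∑ s ∈ Finset.range L, reward ω b s - L * μ b ≤ -(L * (gap μ i / 2))}]

/-- The survivor of a best arm has competed for the same cell and has at least the same empirical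
mean. These two events are independent, and the first has probability at most `1 / k`. -/
lemma law_real_survivor_eq_le {n k T : ℕ} [NeZero k] (hk : k ≤ n) (μ : Fin n → unitInterval)
    {L : ℕ} (hL : 0 < L) (hT : L ≤ T) {b : Fin n} (hb : gap μ b = 0) {i : Fin n} (hi : i ≠ b) :
    (law k T μ).real {ω | survivor hk L b ω = i} ≤
      2 * Real.exp (-(L * gap μ i ^ 2 / 2)) / k := by
  let c₀ : Fin n → Fin k := fun _ => 0
  let R : Set (Fin n × Fin T → Bool) :=
    {x | exploreMean L (x, c₀) b ≤ exploreMean L (x, c₀) i}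
  let S : Set (Fin n → Fin k) := {c | assignedCell c i = assignedCell c b}
  have hmem (ω : Outcome n k T) : ω.1 ∈ R ↔ exploreMean L ω b ≤ exploreMean L ω i := Iff.rfl
  have hsub : {ω : Outcome n k T | survivor hk L b ω = i} ⊆ R ×ˢ S := by
    rintro ω rfl
    exact Set.mem_prod.2 ⟨(hmem ω).2 (exploreMean_le_cells_assignedCell hk L ω _ b (by omega)),
      assignedCell_cells hk L ω _ _⟩
  have hR : (rewardLaw T μ).real R ≤ 2 * Real.exp (-(L * gap μ i ^ 2 / 2)) := by
    rw [← law_real_fst (k := k)]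
    exact law_real_exploreMean_le_exploreMean_le (k := k) μ hL hT hb i
  calc (law k T μ).real {ω | survivor hk L b ω = i}
      ≤ (law k T μ).real (R ×ˢ S) := measureReal_mono hsub
    _ = (rewardLaw T μ).real R *
        (Measure.pi fun _ : Fin n => uniformOn (Set.univ : Set (Fin k))).real S := by
      rw [law, measureReal_prod_prod]
    _ ≤ 2 * Real.exp (-(L * gap μ i ^ 2 / 2)) * (1 / k) :=
      mul_le_mul hR (pi_uniformOn_real_assignedCell_eq_le hi) measureReal_nonneg (by positivity)
    _ = _ := by ring

lemma integral_gap_survivor_le {n k T : ℕ} [NeZero k] (hk : k ≤ n) (μ : Fin n → unitInterval)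
    {L : ℕ} (hL : 0 < L) (hT : L ≤ T) {b : Fin n} (hb : gap μ b = 0) :
    ∫ ω, gap μ (survivor hk L b ω) ∂(law k T μ) ≤
      ∑ i, gap μ i * (2 * Real.exp (-(L * gap μ i ^ 2 / 2)) / k) := by
  have hrw (ω : Outcome n k T) : gap μ (survivor hk L b ω) =
      ∑ i, gap μ i * {ω | survivor hk L b ω = i}.indicator 1 ω := by
    simp [Set.indicator_apply]
  simp only [hrw]
  rw [integral_finsetSum _ fun _ _ => Integrable.of_finite]
  refine Finset.sum_le_sum fun i _ => ?_
  rw [integral_const_mul, integral_indicator_one (Set.toFinite _).measurableSet]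
  by_cases hi : i = b
  · simp [hi, hb]
  · exact mul_le_mul_of_nonneg_left (law_real_survivor_eq_le hk μ hL hT hb hi) (gap_nonneg μ i)

/-! ### The expected regret -/

theorem integral_regret_pulledArm_le {n k T : ℕ} [NeZero k] (hk : k ≤ n)
    (μ : Fin n → unitInterval) {L : ℕ} (hL : 0 < L) {δ : ℝ} (hδ0 : 0 < δ) (hδ1 : δ ≤ 1)
    {tie : ℕ → Finset (Fin n) → Fin n} (htie : ∀ u S, S.Nonempty → tie u S ∈ S)
    (hT : L * n ≤ T) :
    ∫ ω, regret μ T (pulledArm hk L δ tie ω) ∂(law k T μ) ≤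
      L * ∑ i, gap μ i +
      2 * T * ∑ i, gap μ i * (2 * Real.exp (-(L * gap μ i ^ 2 / 2)) / k) +
      ∑ i with 0 < gap μ i, (gap μ i + 32 * Real.log (1 / δ) / gap μ i) +
      T * (∑ i, gap μ i) * (2 * n * T * δ ^ 4) := by
  have hk0 : 0 < k := Nat.pos_of_ne_zero (NeZero.ne k)
  obtain ⟨b, hb⟩ := exists_gap_eq_zero (hk0.trans_le hk) μ
  have hLT : L ≤ T := (Nat.le_mul_of_pos_right L (hk0.trans_le hk)).trans hT
  have hlog : 0 ≤ Real.log (1 / δ) := Real.log_nonneg (by rw [le_div_iff₀ hδ0]; linarith)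
  have hsum : 0 ≤ ∑ i, gap μ i := Finset.sum_nonneg fun i _ => gap_nonneg μ i
  have hpath (ω : Outcome n k T) : regret μ T (pulledArm hk L δ tie ω) ≤
      L * ∑ i, gap μ i + 2 * T * gap μ (survivor hk L b ω) +
      ∑ i with 0 < gap μ i, (gap μ i + 32 * Real.log (1 / δ) / gap μ i) +
      T * (∑ i, gap μ i) * {ω | ¬ Concentrated μ L δ ω}.indicator (1 : Outcome n k T → ℝ) ω := by
    by_cases hω : Concentrated μ L δ ω
    · have := regret_le_of_concentrated hk hk0 hL htie hω hlog hT
        (cells_mem_finalArms hk L ω (assignedCell ω.2 b))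
      simpa [hω, survivor] using this
    · have h1 := regret_le_mul_sum_gap μ T (pulledArm hk L δ tie ω)
      have h2 : 0 ≤ L * ∑ i, gap μ i := by positivity
      have h3 : 0 ≤ 2 * T * gap μ (survivor hk L b ω) := mul_nonneg (by positivity) (gap_nonneg μ _)
      have h4 : 0 ≤ ∑ i with 0 < gap μ i, (gap μ i + 32 * Real.log (1 / δ) / gap μ i) :=
        Finset.sum_nonneg fun i hi => by have := (Finset.mem_filter.1 hi).2; positivity
      have h5 : {ω : Outcome n k T | ¬ Concentrated μ L δ ω}.indicator (1 : Outcome n k T → ℝ) ω = 1 := by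
        simp [hω]
      rw [h5]
      linarith
  refine (integral_mono Integrable.of_finite Integrable.of_finite hpath).trans ?_
  rw [integral_add Integrable.of_finite Integrable.of_finite,
    integral_add Integrable.of_finite Integrable.of_finite,
    integral_add Integrable.of_finite Integrable.of_finite, integral_const_mul (2 * (T : ℝ)),
    integral_const_mul ((T : ℝ) * ∑ i, gap μ i), integral_indicator_one (Set.toFinite _).measurableSet, integral_const, integral_const,
    probReal_univ, one_smul, one_smul]
  gcongr
  · exact integral_gap_survivor_le hk μ hL hLT hb
  · exact law_real_not_concentrated_le μ L hδ0 hδ1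

/-! ### The choice of the number of exploration pulls -/

/-- The number of exploration pulls per arm before it is rounded up. -/
noncomputable def exploreScale (α x : ℝ) : ℝ :=
  (2 * α / Real.exp 1) ^ (α / (α + 1)) * x ^ (1 / (α + 1))

lemma exploreScale_pos {α x : ℝ} (hα : 1 ≤ α) (hx : 0 < x) : 0 < exploreScale α x := by
  unfold exploreScale; positivity

lemma exploreScale_rpow {α x : ℝ} (hα : 1 ≤ α) (hx : 0 < x) :
    exploreScale α x ^ (α + 1) = (2 * α / Real.exp 1) ^ α * x := by
  have h : α + 1 ≠ 0 := by linarith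
  unfold exploreScale
  rw [Real.mul_rpow (by positivity) (by positivity), ← Real.rpow_mul (by positivity),
    ← Real.rpow_mul hx.le, div_mul_cancel₀ _ h, div_mul_cancel₀ _ h, Real.rpow_one]

/-- The scale of exploration is chosen such that the `x` rounds lost by a misranking of gap `g` are,
after weighting with the probability of a misranking, balanced by the cost of exploration. The
exponential bound is `e * z ≤ exp z` at `z = B * g ^ 2 / (2 * α)`, where `B` is the scale. -/
lemma mul_exp_neg_le_exploreScale {α x g L : ℝ} (hα : 1 ≤ α) (hx : 0 < x) (hg : 0 < g)
    (hL : exploreScale α x ≤ L) :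
    g * (x * Real.exp (-(L * g ^ 2 / 2))) ≤ exploreScale α x * g ^ (1 - 2 * α) := by
  set B := exploreScale α x with hB
  have hB0 : 0 < B := exploreScale_pos hα hx
  have hα0 : 0 < α := by linarith
  set z := B * g ^ 2 / (2 * α) with hz
  have hz0 : 0 < z := by positivity
  have hxg : x * g ^ (2 * α) = B * (Real.exp 1 * z) ^ α := by
    have h1 : Real.exp 1 * z = B * g ^ 2 / (2 * α / Real.exp 1) := by rw [hz]; field_simp
    have h2 : (g ^ 2) ^ α = g ^ (2 * α) := by
      rw [← Real.rpow_natCast, ← Real.rpow_mul hg.le]; norm_num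
    have h3 : B * B ^ α = (2 * α / Real.exp 1) ^ α * x := by
      rw [← exploreScale_rpow hα hx, ← hB, Real.rpow_add hB0, Real.rpow_one, mul_comm]
    have h4 : 0 < (2 * α / Real.exp 1) ^ α := by positivity
    rw [h1, Real.div_rpow (by positivity) (by positivity), Real.mul_rpow hB0.le (by positivity), h2]
    field_simp
    rw [h3]; ring
  have hexp : (Real.exp 1 * z) ^ α ≤ Real.exp (L * g ^ 2 / 2) := by
    have h1 : Real.exp 1 * z ≤ Real.exp z := by
      have := Real.add_one_le_exp (z - 1)
      rw [sub_add_cancel, Real.exp_sub, le_div_iff₀ (Real.exp_pos 1)] at this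
      linarith
    calc (Real.exp 1 * z) ^ α ≤ Real.exp z ^ α := by gcongr
      _ = Real.exp (B * g ^ 2 / 2) := by rw [← Real.exp_mul, hz]; congr 1; field_simp
      _ ≤ _ := by gcongr
  have hpow : g ^ (1 - 2 * α) = g / g ^ (2 * α) := by rw [Real.rpow_sub hg, Real.rpow_one]
  have hg2 : 0 < g ^ (2 * α) := by positivity
  rw [hpow, Real.exp_neg, ← mul_div_assoc, le_div_iff₀ hg2]
  calc g * (x * (Real.exp (L * g ^ 2 / 2))⁻¹) * g ^ (2 * α)
      = g * (x * g ^ (2 * α)) * (Real.exp (L * g ^ 2 / 2))⁻¹ := by ring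
    _ = g * B * ((Real.exp 1 * z) ^ α * (Real.exp (L * g ^ 2 / 2))⁻¹) := by rw [hxg]; ring
    _ ≤ g * B * 1 := by
      gcongr
      rw [← div_eq_mul_inv]
      exact div_le_one_of_le₀ hexp (Real.exp_pos _).le
    _ = B * g := by ring

open Filter in
/-- For long games the exploration fits into the game, and its scale dominates any constant and
the logarithmic regret of UCB. -/
lemma eventually_exploreScale (α κ : ℝ) (hα : 1 ≤ α) (hκ : 1 ≤ κ) (n m : ℕ) (hm : 0 < m) :
    ∀ᶠ T : ℕ in atTop, 1 ≤ T ∧ 1 ≤ exploreScale α (T / m) ∧ 2 * n ≤ exploreScale α (T / m) ∧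
      n * (2 * exploreScale α (T / m)) ≤ T ∧
      1 + 32 * (κ * Real.log T) ≤ exploreScale α (T / m) := by
  have hα1 : 0 < α + 1 := by linarith
  have hm0 : (0 : ℝ) < m := by exact_mod_cast hm
  set p := 1 / (α + 1) with hp
  have hp0 : 0 < p := by positivity
  have hp1 : 0 < 1 - p := by
    rw [hp, sub_pos, div_lt_one hα1]; linarith
  set D := (2 * α / Real.exp 1) ^ (α / (α + 1)) / (m : ℝ) ^ p with hD
  have hD0 : 0 < D := by positivity
  have hform (T : ℕ) : exploreScale α (T / m) = D * (T : ℝ) ^ p := by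
    rw [exploreScale, Real.div_rpow (by positivity) hm0.le]; ring
  have hnat := tendsto_natCast_atTop_atTop (R := ℝ)
  have hpow := ((tendsto_rpow_atTop hp0).comp hnat).const_mul_atTop hD0
  have hpow' := (tendsto_rpow_atTop hp1).comp hnat
  have hlog := hnat.eventually ((isLittleO_log_rpow_atTop hp0).bound
    (show 0 < D / (64 * κ) by positivity))
  filter_upwards [eventually_ge_atTop 1, hpow.eventually_ge_atTop 2,
    hpow.eventually_ge_atTop (2 * n : ℝ), hpow'.eventually_ge_atTop (n * (2 * D)), hlog]
    with T h1 h2 h3 h4 h5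
  simp only [Function.comp_apply] at h2 h3 h4
  have hT0 : (0 : ℝ) < T := by exact_mod_cast h1
  rw [hform]
  refine ⟨h1, by linarith, h3, ?_, ?_⟩
  · calc n * (2 * (D * (T : ℝ) ^ p)) = n * (2 * D) * (T : ℝ) ^ p := by ring
      _ ≤ (T : ℝ) ^ (1 - p) * (T : ℝ) ^ p := by gcongr
      _ = T := by rw [← Real.rpow_add hT0]; simp
  · have h6 : Real.log T ≤ D / (64 * κ) * (T : ℝ) ^ p := by
      refine (le_abs_self _).trans (h5.trans (le_of_eq ?_))
      rw [Real.norm_of_nonneg (by positivity)]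
    have h7 : 32 * (κ * Real.log T) ≤ 32 * (κ * (D / (64 * κ) * (T : ℝ) ^ p)) := by gcongr
    have h8 : 32 * (κ * (D / (64 * κ) * (T : ℝ) ^ p)) = D * (T : ℝ) ^ p / 2 := by field_simp; norm_num
    linarith

lemma le_rpow_one_sub_two_mul {α g : ℝ} (hα : 1 ≤ α) (hg : 0 < g) (hg1 : g ≤ 1) :
    g ≤ g ^ (1 - 2 * α) := by
  simpa using Real.rpow_le_rpow_of_exponent_ge hg hg1 (show 1 - 2 * α ≤ 1 by linarith)

lemma inv_le_rpow_one_sub_two_mul {α g : ℝ} (hα : 1 ≤ α) (hg : 0 < g) (hg1 : g ≤ 1) :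
    g⁻¹ ≤ g ^ (1 - 2 * α) := by
  rw [← Real.rpow_neg_one]
  exact Real.rpow_le_rpow_of_exponent_ge hg hg1 (by linarith)

end StreamingBandit

open MeasureTheory StreamingBandit in
theorem theorem4 :
    ∃ C : ℝ, 0 < C ∧
      ∀ (α κ : ℝ), 1 ≤ α → 1 ≤ κ →
      ∀ (n m : ℕ), 2 ≤ m → ∀ (hmn : 3 * m < 2 * n),
      ∃ T₀ : ℕ, ∀ T : ℕ, T₀ ≤ T →
      ∀ (μ : Fin n → unitInterval) (tie : ℕ → Finset (Fin n) → Fin n),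
      (∀ (u : ℕ) (S : Finset (Fin n)), S.Nonempty → tie u S ∈ S) →
      (∀ ω : Outcome n (m - 1) T,
        IsSinglePass m T (memoryAt (pred_le_of_small hmn) (explorePulls α m T) ω)
          (pulledArm (pred_le_of_small hmn) (explorePulls α m T) ((T : ℝ) ^ (-κ)) tie ω)) ∧
      ∫ ω, regret μ T
          (pulledArm (pred_le_of_small hmn) (explorePulls α m T) ((T : ℝ) ^ (-κ)) tie ω)
          ∂(law (m - 1) T μ) ≤
        C * ((2 * α / Real.exp 1) ^ (α / (α + 1)) * ((T : ℝ) / m) ^ (1 / (α + 1)) *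
          ∑ i : Fin n with 0 < gap μ i, gap μ i ^ (1 - 2 * α)) := by
  refine ⟨12, by norm_num, fun α κ hα hκ n m hm hmn => ?_⟩
  obtain ⟨T₀, hT₀⟩ := Filter.eventually_atTop.1
    (eventually_exploreScale α κ hα hκ n m (by omega))
  refine ⟨T₀, fun T hT μ tie htie => ?_⟩
  obtain ⟨hT1, hB1, hBn, hBT, hBlog⟩ := hT₀ T hT
  have hT0 : (0 : ℝ) < T := by exact_mod_cast hT1
  have hm0 : (0 : ℝ) < m := by exact_mod_cast (by omega : 0 < m)
  have hk0 : 0 < m - 1 := by omega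
  have hk0' : (0 : ℝ) < (m - 1 : ℕ) := by exact_mod_cast hk0
  constructor
  · intro ω
    have h := isSinglePass_memoryAt (pred_le_of_small hmn) hk0 (by omega) (explorePulls α m T)
      ((T : ℝ) ^ (-κ)) htie ω
    rwa [Nat.sub_add_cancel (by omega)] at h
  have : NeZero (m - 1) := ⟨hk0.ne'⟩
  change _ ≤ 12 * (exploreScale α (T / m) * ∑ i : Fin n with 0 < gap μ i, gap μ i ^ (1 - 2 * α))
  set B := exploreScale α (T / m) with hB
  set L := explorePulls α m T with hL
  set S := ∑ i : Fin n with 0 < gap μ i, gap μ i ^ (1 - 2 * α) with hS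
  have hBL : B ≤ L := Nat.le_ceil _
  have hLB : (L : ℝ) ≤ 2 * B := by
    have : (L : ℝ) < B + 1 := Nat.ceil_lt_add_one (zero_le_one.trans hB1)
    linarith
  have hL0 : 0 < L := by exact_mod_cast (show (0 : ℝ) < L by linarith)
  have hLn : L * n ≤ T := by
    have : (L : ℝ) * n ≤ T := by
      calc (L : ℝ) * n ≤ 2 * B * n := by gcongr
        _ = n * (2 * B) := by ring
        _ ≤ T := hBT
    exact_mod_cast this
  have hδ0 : 0 < (T : ℝ) ^ (-κ) := Real.rpow_pos_of_pos hT0 _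
  have hδT : (T : ℝ) ^ (-κ) ≤ (T : ℝ)⁻¹ := by
    rw [← Real.rpow_neg_one]
    exact Real.rpow_le_rpow_of_exponent_le (by exact_mod_cast hT1) (by linarith)
  have hTinv : (T : ℝ)⁻¹ ≤ 1 := inv_le_one_of_one_le₀ (by exact_mod_cast hT1)
  have hlogδ : Real.log (1 / (T : ℝ) ^ (-κ)) = κ * Real.log T := by
    rw [one_div, Real.log_inv, Real.log_rpow hT0]; ring
  have hlogT : 0 ≤ κ * Real.log T :=
    mul_nonneg (by linarith) (Real.log_nonneg (by exact_mod_cast hT1))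
  have hgapS : ∑ i, gap μ i ≤ S := by
    have := sum_filter_gap_pos μ fun _ => 1
    simp only [mul_one] at this
    rw [← this]
    exact Finset.sum_le_sum fun i hi =>
      le_rpow_one_sub_two_mul hα (Finset.mem_filter.1 hi).2 (gap_le_one μ i)
  have hgap0 : 0 ≤ ∑ i, gap μ i := Finset.sum_nonneg fun i _ => gap_nonneg μ i
  have hmisrank : 2 * T * ∑ i, gap μ i * (2 * Real.exp (-(L * gap μ i ^ 2 / 2)) / (m - 1 : ℕ)) ≤
      8 * B * S := by
    rw [← sum_filter_gap_pos, hS, Finset.mul_sum, Finset.mul_sum]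
    refine Finset.sum_le_sum fun i hi => ?_
    have h := mul_exp_neg_le_exploreScale hα (div_pos hT0 hm0) (Finset.mem_filter.1 hi).2 hBL
    have hTk : (T : ℝ) / (m - 1 : ℕ) ≤ 2 * (T / m) := by
      have : (m : ℝ) ≤ 2 * (m - 1 : ℕ) := by exact_mod_cast (by omega : m ≤ 2 * (m - 1))
      rw [div_le_iff₀ hk0']
      calc (T : ℝ) = T / m * m := by field_simp
        _ ≤ T / m * (2 * (m - 1 : ℕ)) := by gcongr
        _ = _ := by ring
    have hg := gap_nonneg μ i
    calc 2 * T * (gap μ i * (2 * Real.exp (-(L * gap μ i ^ 2 / 2)) / (m - 1 : ℕ)))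
        = 4 * gap μ i * (T / (m - 1 : ℕ)) * Real.exp (-(L * gap μ i ^ 2 / 2)) := by ring
      _ ≤ 4 * gap μ i * (2 * (T / m)) * Real.exp (-(L * gap μ i ^ 2 / 2)) := by gcongr
      _ = 8 * (gap μ i * (T / m * Real.exp (-(L * gap μ i ^ 2 / 2)))) := by ring
      _ ≤ 8 * (B * gap μ i ^ (1 - 2 * α)) := by gcongr
      _ = _ := by ring
  have hucb : ∑ i with 0 < gap μ i, (gap μ i + 32 * (κ * Real.log T) / gap μ i) ≤ B * S := by
    rw [hS, Finset.mul_sum]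
    refine Finset.sum_le_sum fun i hi => ?_
    have hg := (Finset.mem_filter.1 hi).2
    have h1 := le_rpow_one_sub_two_mul hα hg (gap_le_one μ i)
    have h2 := inv_le_rpow_one_sub_two_mul hα hg (gap_le_one μ i)
    calc gap μ i + 32 * (κ * Real.log T) / gap μ i
        ≤ gap μ i ^ (1 - 2 * α) + 32 * (κ * Real.log T) * gap μ i ^ (1 - 2 * α) := by
          rw [div_eq_mul_inv]; gcongr
      _ = (1 + 32 * (κ * Real.log T)) * gap μ i ^ (1 - 2 * α) := by ring
      _ ≤ _ := by gcongr
  have hfail : T * (∑ i, gap μ i) * (2 * n * T * ((T : ℝ) ^ (-κ)) ^ 4) ≤ B * S := by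
    have h1 : (T : ℝ) * (T * ((T : ℝ) ^ (-κ)) ^ 4) ≤ 1 := by
      calc (T : ℝ) * (T * ((T : ℝ) ^ (-κ)) ^ 4) ≤ T * (T * (T : ℝ)⁻¹ ^ 4) := by gcongr
        _ = (T : ℝ)⁻¹ ^ 2 := by field_simp
        _ ≤ 1 := pow_le_one₀ (by positivity) hTinv
    calc T * (∑ i, gap μ i) * (2 * n * T * ((T : ℝ) ^ (-κ)) ^ 4)
        = 2 * n * (∑ i, gap μ i) * (T * (T * ((T : ℝ) ^ (-κ)) ^ 4)) := by ring
      _ ≤ 2 * n * (∑ i, gap μ i) * 1 := by gcongr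
      _ ≤ B * S := by rw [mul_one]; gcongr
  have hexplore : L * ∑ i, gap μ i ≤ 2 * B * S := by gcongr
  have hmain := integral_regret_pulledArm_le (pred_le_of_small hmn) μ hL0 hδ0 (hδT.trans hTinv) htie
    hLn
  rw [hlogδ] at hmain
  linarith
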